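/- Let $G$ be an additively written abelian group. A sequence over $G$ is a finite unordered sequence of elements of $G$ with repetition allowed (a finite multiset), written multiplicatively; it is zero-sum if the sum of its terms is $0$. Let $\mathcal B(G)$ be the set of all zero-sum sequences over $G$ (including the empty one). For a set $\Omega$ of sequences over $G$, let $\mathsf d_\Omega(G)$ be the smallest positive integer $\ell$ such that every sequence over $G$ of length $\ell$ has a subsequence belonging to $\Omega$, and $\mathsf d_\Omega(G)=\infty$ if no such $\ell$ exists. For a positive integer $t$ put $$Q_t(G)=\bigcap_{\Omega\subseteq\mathcal B(G),\ \mathsf d_\Omega(G)=t}\Omega .$$ **Theorem.** Let $G$ be a finite cyclic group of order $n\ge 3$. Then (i) $Q_n(G)=\{a^{\operatorname{ord}(a)} : a\in G,\ \operatorname{ord}(a)\in\{1,\tfrac n2,n\}\}\cup\{g^{k}\cdot(-kg) : g\in G,\ \operatorname{ord}(g)=n,\ 1\le k\le n-2\}$; (ii) $Q_t(G)=\{a^{\operatorname{ord}(a)} : a\in G,\ \operatorname{ord}(a)=n\}$ for every integer $t$ with $n+1\le t\le 2n-1$; (iii) $Q_t(G)=\emptyset$ for every integer $t\ge 2n$.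 -/

import Mathlib

/-- A (finite, unordered) sequence over `G`, repetition allowed, is a multiset: multiplication of
sequences is `+`, the empty sequence is `0`, `W` is a subsequence of `T` when `W ≤ T`, and `|T|` is
`Multiset.card T`. This is the set `ℬ(G)` of zero-sum sequences over `G`. -/
def zeroSumSequences (G : Type*) [AddCommGroup G] : Set (Multiset G) :=
  {T | T.sum = 0}

/-- The universal zero-sum invariant `d_Ω(G)`: the smallest positive integer `ℓ` such that every
sequence over `G` of length `ℓ` has a subsequence in `Ω`, and `∞` if there is none. -/
noncomputable def universalInvariant {G : Type*} (Ω : Set (Multiset G)) : ℕ∞ :=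
  sInf {d : ℕ∞ | ∃ l : ℕ, d = (l : ℕ∞) ∧ 0 < l ∧
    ∀ T : Multiset G, Multiset.card T = l → ∃ W, W ≤ T ∧ W ∈ Ω}

/-- `Q_t(G)`: the intersection of all sets `Ω` of zero-sum sequences over `G` with
`d_Ω(G) = t`. -/
def Qset (G : Type*) [AddCommGroup G] (t : ℕ) : Set (Multiset G) :=
  ⋂₀ {Ω : Set (Multiset G) | Ω ⊆ zeroSumSequences G ∧ universalInvariant Ω = (t : ℕ∞)}

/-! If some `T` of length `t ≥ 2` has `W` as its only nonempty zero-sum subsequence, then every `Ω`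
with invariant `t` must contain `W`, since such an `Ω` cannot contain the empty sequence. This gives
the inclusions from right to left, by explicit choices of `T`. For the other inclusions an `Ω`
avoiding `W` is built. It must be met by every sequence of length `t`, yet missed by some `S` of
length `t - 1`, so for `t > n` the set of all other nonempty zero-sum sequences is too large and has
to be thinned.

What remains is to classify the pairs `T`, `W` with `|T| ≥ n`. Order `T` so that `W` comes first and
no interval other than this initial one is zero-sum; then the nonempty prefix sums are distinct and
`|T| ≤ n`. If `|T| > n`, no such order exists and `T` is constant
(`IsUniqueZeroSum.eq_replicate_of_card_lt`). If `|T| = n`, these sums fill `G`, which leaves only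
the extremal shapes (`IsUniqueZeroSum.isExtremal`); the delicate case is that of two distinct terms
(`eq_one_of_unique_pair`). -/

/-- `W` is the only nonempty zero-sum subsequence of `T`. -/
def IsUniqueZeroSum {G : Type*} [AddCommGroup G] (T W : Multiset G) : Prop :=
  W ≤ T ∧ W ≠ 0 ∧ W.sum = 0 ∧ ∀ V ≤ T, V ≠ 0 → V.sum = 0 → V = W

/-! ### Distinct prefix sums and Davenport-type bounds -/

section PrefixSums

variable {G : Type*} [AddCommGroup G]

/-- Two equal prefix sums differ by a zero-sum interval. Taking `k = 0` suits zero-sum free lists;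
`k = 1` tolerates zero-sum intervals that start at the first term. -/
theorem prefixSum_injOn {L : List G} {k : ℕ}
    (h : ∀ A B C, L = A ++ B ++ C → k ≤ A.length → B ≠ [] → B.sum ≠ 0) :
    Set.InjOn (fun i => (L.take i).sum) (Finset.Icc k L.length : Set ℕ) := by
  have key : ∀ i j, k ≤ i → i < j → j ≤ L.length → (L.take i).sum ≠ (L.take j).sum := by
    intro i j hk hij hj heq
    have h1 : L.take j = L.take i ++ (L.take j).drop i := by
      conv_lhs => rw [← List.take_append_drop i (L.take j)]
      rw [List.take_take, min_eq_left hij.le]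
    refine h (L.take i) ((L.take j).drop i) (L.drop j) ?_ ?_ ?_ ?_
    · rw [← h1, List.take_append_drop]
    · simp; omega
    · intro h0
      have := congrArg List.length h0
      simp at this; omega
    · rw [h1, List.sum_append] at heq
      simpa using heq
  intro i hi j hj hij
  simp only [Finset.coe_Icc, Set.mem_Icc] at hi hj
  rcases lt_trichotomy i j with hlt | heq | hlt
  · exact absurd hij (key i j hi.1 hlt hj.2)
  · exact heq
  · exact absurd hij.symm (key j i hj.1 hlt hi.2)

theorem length_add_one_le_card_add [Finite G] {L : List G} {k : ℕ}
    (h : ∀ A B C, L = A ++ B ++ C → k ≤ A.length → B ≠ [] → B.sum ≠ 0) :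
    L.length + 1 ≤ Nat.card G + k := by
  classical
  have := Fintype.ofFinite G
  have h1 := Finset.card_image_of_injOn (prefixSum_injOn h)
  have h2 := Finset.card_le_univ ((Finset.Icc k L.length).image fun i => (L.take i).sum)
  rw [h1, Nat.card_Icc] at h2
  rw [Nat.card_eq_fintype_card]
  omega

theorem length_add_two_le_card_add [Finite G] {L : List G} {k : ℕ} {e : G}
    (h : ∀ A B C, L = A ++ B ++ C → k ≤ A.length → B ≠ [] → B.sum ≠ 0)
    (he : ∀ A C, L = A ++ C → k ≤ A.length → A.sum ≠ e) :
    L.length + 2 ≤ Nat.card G + k := by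
  classical
  have := Fintype.ofFinite G
  have h1 := Finset.card_image_of_injOn (prefixSum_injOn h)
  have hn : e ∉ (Finset.Icc k L.length).image fun i => (L.take i).sum := by
    simp only [Finset.mem_image, Finset.mem_Icc, not_exists, not_and]
    rintro i ⟨hi, hi'⟩
    exact he _ (L.drop i) (List.take_append_drop i L).symm (by simp; omega)
  have h2 := Finset.card_le_univ (insert e ((Finset.Icc k L.length).image fun i => (L.take i).sum))
  rw [Finset.card_insert_of_notMem hn, h1, Nat.card_Icc] at h2
  rw [Nat.card_eq_fintype_card]
  omega

/-- Davenport's bound, relative to a homomorphism. -/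
theorem exists_le_map_sum_eq_zero {H : Type*} [AddCommGroup H] [Finite H] (f : G →+ H)
    (T : Multiset G) (hT : Nat.card H ≤ Multiset.card T) :
    ∃ V ≤ T, V ≠ 0 ∧ f V.sum = 0 := by
  by_contra! hcon
  induction T using Quotient.inductionOn with
  | h L =>
    have := length_add_one_le_card_add (L := L.map f) (k := 0) ?_
    · simp at this hT; omega
    intro A B C hABC _ hB hsum
    obtain ⟨AB, C', rfl, hAB, rfl⟩ := List.map_eq_append_iff.1 hABC
    obtain ⟨A', B', rfl, rfl, rfl⟩ := List.map_eq_append_iff.1 hAB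
    refine hcon (B' : Multiset G) ?_ ?_ ?_
    · exact Multiset.coe_le.2
        (List.Sublist.subperm (by simp))
    · simpa using hB
    · simpa [map_list_sum] using hsum

theorem exists_le_sum_eq_zero [Finite G] (T : Multiset G) (hT : Nat.card G ≤ Multiset.card T) :
    ∃ V ≤ T, V ≠ 0 ∧ V.sum = 0 :=
  exists_le_map_sum_eq_zero (AddMonoidHom.id G) T hT

/-- A zero-sum free sequence of length `|G| - 1` is constant. -/
theorem eq_of_zeroSumFree [Finite G] {T : Multiset G} (hT : Multiset.card T + 1 = Nat.card G)
    (hfree : ∀ V ≤ T, V ≠ 0 → V.sum ≠ 0) {x y : G} (hx : x ∈ T) (hy : y ∈ T) : x = y := by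
  by_contra hxy
  obtain ⟨T₁, rfl⟩ := Multiset.exists_cons_of_mem hx
  have hy' : y ∈ T₁ := (Multiset.mem_cons.1 hy).resolve_left (Ne.symm hxy)
  obtain ⟨T₂, rfl⟩ := Multiset.exists_cons_of_mem hy'
  induction T₂ using Quotient.inductionOn with
  | h L =>
    have hfree' : ∀ B : List G, List.Sublist B (x :: y :: L) → B ≠ [] → B.sum ≠ 0 := by
      intro B hB hB0 hs
      exact hfree (B : Multiset G) (Multiset.coe_le.2 hB.subperm) (by simpa using hB0)
        (by simpa using hs)
    -- With `x`, `y` in front, `y` is never a prefix sum: `x + y + D = y` would make `x`, `D`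
    -- zero-sum. One value is lost, so the list is too long.
    have := length_add_two_le_card_add (L := x :: y :: L) (k := 0) (e := y) ?_ ?_
    · simp at this hT; omega
    · intro A B C h _ hB
      exact hfree' B (h ▸ by simp) hB
    · intro A C h _ hA
      match A with
      | [] => exact hfree' [y] (by simp) (by simp) (by simpa using hA.symm)
      | [a] =>
        simp only [List.cons_append, List.cons.injEq] at h
        exact hxy (by simpa [h.1] using hA)
      | a :: b :: D =>
        simp only [List.cons_append, List.cons.injEq] at h
        obtain ⟨rfl, rfl, rfl⟩ := h
        refine hfree' (x :: D) (by simp) (by simp) ?_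
        simp only [List.sum_cons] at hA ⊢
        rw [add_left_comm] at hA
        simpa using hA

end PrefixSums

/-! ### Length bounds from a unique zero-sum subsequence -/

section UniqueZeroSum

variable {G : Type*} [AddCommGroup G]

theorem IsUniqueZeroSum.not_le_sub [DecidableEq G] {T W : Multiset G} (h : IsUniqueZeroSum T W) :
    ¬ W ≤ T - W := by
  obtain ⟨hle, h0, hs, hu⟩ := h
  intro hW
  have h2 : W + W ≤ T := by
    calc W + W ≤ (T - W) + W := by gcongr
      _ = T := Multiset.sub_add_cancel hle
  have := hu (W + W) h2 (by simpa using h0) (by simp [hs])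
  exact h0 (by simpa using this)

/-- If the terms of `W` are ordered with all copies of `z` last, and the remaining terms of `T`
with `z` first, then no interval other than the initial one is zero-sum. -/
theorem IsUniqueZeroSum.interval_sum_ne_zero {p q u : List G} {y z : G}
    (h : IsUniqueZeroSum (((p ++ q) ++ z :: u : List G) : Multiset G) ((p ++ q : List G)))
    (hp : z ∉ p) (hq : ∀ x ∈ q, x = z) (hyz : y ≠ z)
    [DecidableEq G] (hy : List.count y (z :: u) < List.count y (p ++ q))
    {A B C : List G} (hABC : (p ++ q) ++ z :: u = A ++ B ++ C) (hA : 1 ≤ A.length)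
    (hB : B ≠ []) : B.sum ≠ 0 := by
  intro hs
  obtain ⟨hle, h0, hs0, hu⟩ := h
  have hBW : (B : Multiset G) = ((p ++ q : List G) : Multiset G) := by
    refine hu _ ?_ (by simpa using hB) (by simpa using hs)
    rw [hABC]
    exact Multiset.coe_le.2 (List.Sublist.subperm (by simp))
  have hperm : B.Perm (p ++ q) := Multiset.coe_eq_coe.1 hBW
  have hqy : List.count y q = 0 := List.count_eq_zero.2 fun hmem => hyz (hq _ hmem)
  -- `B` uses as many copies of `y` as `W` has, so `A` holds at most those outside `W`. Hence `A`
  -- cannot contain all of `p`, where every `y` of `W` lies.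
  have hcount : List.count y A ≤ List.count y (z :: u) := by
    have h1 := congrArg (List.count y) hABC
    have h2 := hperm.count_eq y
    simp only [List.count_append] at h1 h2
    omega
  rw [List.append_assoc A] at hABC
  rcases List.append_eq_append_iff.1 hABC with ⟨D, hD, hD'⟩ | ⟨D, hD, hD'⟩
  · rw [hD, List.count_append] at hcount
    omega
  · have hlen := hperm.length_eq
    have hlen' := congrArg List.length hD
    simp only [List.length_append] at hlen hlen'
    rcases List.append_eq_append_iff.1 hD'.symm with ⟨E, hE, hE'⟩ | ⟨E, hE, hE'⟩
    · have h3 := congrArg List.length hE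
      simp only [List.length_append] at h3
      match E, hE', h3 with
      | [], _, h3 => simp at h3; omega
      | e :: E, hE', _ =>
        simp only [List.cons_append, List.cons.injEq] at hE'
        obtain ⟨rfl, -⟩ := hE'
        -- `B` straddles the end of `W`: cancelling the common part `D` from `W = A ++ D` and `B = D
        -- ++ z :: E` puts `z` into `A`. As `z` occurs in `W` only after `p`, this forces `A` to
        -- contain `p`.
        have hAE : A.Perm (z :: E) := by
          have : (D ++ A).Perm (D ++ z :: E) := by
            rw [← hE]
            refine List.perm_append_comm.trans ?_
            rw [← hD]
            exact hperm.symm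
          exact (List.perm_append_left_iff D).1 this
        have hzA : z ∈ A := hAE.mem_iff.2 (by simp)
        rcases List.append_eq_append_iff.1 hD with ⟨F, hF, hF'⟩ | ⟨F, hF, hF'⟩
        · rw [hF, List.count_append] at hcount
          rw [List.count_append] at hy
          omega
        · exact hp (hF ▸ List.mem_append_left _ hzA)
    · have h3 := congrArg List.length hE
      simp only [List.length_append] at h3
      omega

variable [DecidableEq G]

theorem IsUniqueZeroSum.exists_lists {T W : Multiset G} (h : IsUniqueZeroSum T W) {z : G}
    (hz : z ∈ T - W) : ∃ q u : List G, (∀ x ∈ q, x = z) ∧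
      (∀ p : List G, (p : Multiset G) = W.filter (· ≠ z) →
        ((p ++ q : List G) : Multiset G) = W ∧ (((p ++ q) ++ z :: u : List G) : Multiset G) = T) ∧
      ((z :: u : List G) : Multiset G) = T - W := by
  obtain ⟨U, hU⟩ := Multiset.exists_cons_of_mem hz
  refine ⟨(W.filter (· = z)).toList, U.toList, ?_, ?_, ?_⟩
  · intro x hx
    simpa using (Multiset.mem_filter.1 (Multiset.mem_toList.1 hx)).2
  · intro p hp
    have h1 : ((p ++ (W.filter (· = z)).toList : List G) : Multiset G) = W := by
      rw [← Multiset.coe_add, hp, Multiset.coe_toList, add_comm]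
      exact Multiset.filter_add_not _ _
    refine ⟨h1, ?_⟩
    rw [← Multiset.coe_add, h1, ← Multiset.cons_coe, Multiset.coe_toList, ← hU]
    exact add_tsub_cancel_of_le h.1
  · rw [← Multiset.cons_coe, Multiset.coe_toList, ← hU]

theorem IsUniqueZeroSum.card_le [Finite G] {T W : Multiset G} (h : IsUniqueZeroSum T W) {y z : G}
    (hz : z ∈ T - W) (hyz : y ≠ z) (hy : (T - W).count y < W.count y) :
    Multiset.card T ≤ Nat.card G := by
  obtain ⟨q, u, hq, hp, hU⟩ := h.exists_lists hz
  have hzp : z ∉ (W.filter (· ≠ z)).toList := by simp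
  obtain ⟨hW, hT⟩ := hp (W.filter (· ≠ z)).toList (by simp)
  generalize (W.filter (· ≠ z)).toList = p at hzp hW hT
  rw [← hU, ← hW, Multiset.coe_count, Multiset.coe_count] at hy
  rw [← hT, ← hW] at h
  have := length_add_one_le_card_add (k := 1) fun A B C hABC hA hB =>
    h.interval_sum_ne_zero hzp hq hyz hy hABC hA hB
  rw [← hT, Multiset.coe_card]
  omega

/-- Starting the list with `x`, `x'` makes `x'` a missing prefix sum, which improves the bound of
`IsUniqueZeroSum.card_le` by one. -/
theorem IsUniqueZeroSum.card_add_one_le [Finite G] {T W : Multiset G} (h : IsUniqueZeroSum T W)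
    {y z : G} (hz : z ∈ T - W) (hyz : y ≠ z) (hy : (T - W).count y < W.count y) {x x' : G}
    (hx : x ∈ W) (hx' : x' ∈ W) (hxz : x ≠ z) (hxz' : x' ≠ z) (hxx' : x ≠ x') :
    Multiset.card T + 1 ≤ Nat.card G := by
  obtain ⟨q, u, hq, hp, hU⟩ := h.exists_lists hz
  obtain ⟨P, hP⟩ := Multiset.exists_cons_of_mem
    (show x ∈ W.filter (· ≠ z) from Multiset.mem_filter.2 ⟨hx, hxz⟩)
  have hx'P : x' ∈ P := by
    have : x' ∈ W.filter (· ≠ z) := Multiset.mem_filter.2 ⟨hx', hxz'⟩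
    rw [hP] at this
    exact (Multiset.mem_cons.1 this).resolve_left hxx'.symm
  obtain ⟨Q, rfl⟩ := Multiset.exists_cons_of_mem hx'P
  have hpl : ((x :: x' :: Q.toList : List G) : Multiset G) = W.filter (· ≠ z) := by
    rw [hP, ← Multiset.cons_coe, ← Multiset.cons_coe, Multiset.coe_toList]
  have hzp : z ∉ (x :: x' :: Q.toList : List G) := by
    rw [← Multiset.mem_coe, hpl]
    simp
  obtain ⟨hW, hT⟩ := hp _ hpl
  rw [← hU, ← hW, Multiset.coe_count, Multiset.coe_count] at hy
  rw [← hT, ← hW] at h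
  have := length_add_two_le_card_add (k := 1) (e := x') (fun A B C hABC hA hB =>
    h.interval_sum_ne_zero hzp hq hyz hy hABC hA hB) ?_
  · rw [← hT, Multiset.coe_card]
    omega
  intro A C hAC hA hsum
  match A with
  | [] => simp at hA
  | [a] =>
    simp only [List.cons_append, List.cons.injEq] at hAC
    exact hxx' (by simpa [hAC.1] using hsum)
  | a :: b :: D =>
    simp only [List.cons_append, List.cons.injEq] at hAC
    obtain ⟨rfl, rfl, hAC⟩ := hAC
    have h1 : ((x :: D : List G) : Multiset G)
        = ((x :: x' :: Q.toList ++ q : List G) : Multiset G) := by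
      refine h.2.2.2 _ ?_ (by simp) ?_
      · simp only [List.cons_append, hAC]
        exact Multiset.coe_le.2 (List.Sublist.subperm (by simp))
      · simp only [List.sum_cons] at hsum
        rw [add_left_comm] at hsum
        simpa using hsum
    have h2 := Multiset.coe_eq_coe.1 h1
    simp only [List.cons_append, List.perm_cons] at h2
    have h3 := h2.length_eq
    -- `x :: D` is a rearrangement of `W` obtained by skipping `x'`, so by length `D` reaches
    -- exactly one term past `W`. That term is `z`, and it replaces `x'`.
    have hxz : z = x' := by
      have h5 : D = (Q.toList ++ q) ++ [z] := by
        have h6 : D ++ C = ((Q.toList ++ q) ++ [z]) ++ u := by simpa using hAC.symm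
        refine (List.append_inj h6 ?_).1
        simp at h3 ⊢; omega
      rw [h5] at h2
      have h7 := Multiset.coe_eq_coe.2 ((List.perm_append_singleton z _).symm.trans h2)
      simpa [← Multiset.cons_coe] using h7
    exact hxz' hxz.symm

end UniqueZeroSum

/-! ### Sequences with two distinct terms -/

section TwoElements

variable {G : Type*} [AddCommGroup G]

theorem addOrderOf_eq_card_of_closure_pair [Finite G] {y z : G} {m : ℤ} (hz : z = m • y)
    (hgen : ∀ e : G, ∃ i j : ℤ, e = i • y + j • z) : addOrderOf y = Nat.card G := by
  rw [← Nat.card_zmultiples, AddSubgroup.card_eq_iff_eq_top]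
  rw [AddSubgroup.eq_top_iff']
  intro e
  obtain ⟨i, j, rfl⟩ := hgen e
  rw [hz, AddSubgroup.mem_zmultiples_iff]
  exact ⟨i + j * m, by rw [add_smul, mul_smul]⟩

/-- If `y ^ b * z ^ a` is the unique zero-sum subsequence of `y ^ (b + d) * z ^ (a + c)`, a sequence
of length `|G|`, then the prefix sums of `y ^ b * z ^ (a + c) * y ^ d` cover `G`. -/
theorem exists_prefix_eq_of_unique_pair [Finite G] {y z : G} {a b c d : ℕ}
    (hc : 1 ≤ c) (hdb : d < b) (hcard : Nat.card G = b + d + (a + c))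
    (hu : ∀ i j : ℕ, i ≤ b + d → j ≤ a + c → i • y + j • z = 0 →
      (i = 0 ∧ j = 0) ∨ (i = b ∧ j = a)) (e : G) :
    ∃ i j : ℕ, e = i • y + j • z ∧ ((j = 0 ∧ 1 ≤ i ∧ i ≤ b) ∨ (i = b ∧ j ≤ a + c) ∨
      (j = a + c ∧ b ≤ i ∧ i ≤ b + d)) := by
  -- `α i` and `β i` count the copies of `y` and `z` in the prefix of length `i + 1`; the empty
  -- prefix is left out because it has the same sum as `y ^ b * z ^ a`.
  let α : ℕ → ℕ := fun i => min (i + 1) b + (i + 1 - (b + a + c))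
  let β : ℕ → ℕ := fun i => min (i + 1 - b) (a + c)
  let f : Fin (b + d + (a + c)) → G := fun i => α i • y + β i • z
  have key : ∀ i j : Fin (b + d + (a + c)), i < j → f i ≠ f j := by
    intro i j hij heq
    have hij' : (i : ℕ) < j := hij
    have hj := j.2
    have h1 : α i ≤ α j := by simp only [α]; omega
    have h2 : β i ≤ β j := by simp only [β]; omega
    have h3 : (α j - α i) • y + (β j - β i) • z = 0 := by
      have h4 : f j = f i + ((α j - α i) • y + (β j - β i) • z) := by
        change α j • y + β j • z = α i • y + β i • z + _
        obtain ⟨m, hm⟩ := Nat.exists_eq_add_of_le h1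
        obtain ⟨m', hm'⟩ := Nat.exists_eq_add_of_le h2
        rw [hm, hm', Nat.add_sub_cancel_left, Nat.add_sub_cancel_left, add_smul (α i) m, add_smul (β i) m']
        exact add_add_add_comm (α i • y) _ _ _
      rw [← heq] at h4
      simpa using h4
    -- A difference of `b` in the first coordinate, with `α i ≥ 1` and `d < b`, runs from the first
    -- block of `y` to the last. It then crosses all `a + c > a` copies of `z`.
    have h5 := hu _ _ (by simp only [α]; omega) (by simp only [β]; omega) h3
    simp only [α, β] at h5
    omega
  have hinj : Function.Injective f := by
    intro i j hij
    rcases lt_trichotomy i j with h | h | h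
    · exact absurd hij (key i j h)
    · exact h
    · exact absurd hij.symm (key j i h)
  obtain ⟨i, rfl⟩ := ((Nat.bijective_iff_injective_and_card f).2 ⟨hinj, by simp [hcard]⟩).2 e
  refine ⟨α i, β i, rfl, ?_⟩
  have hi := i.2
  simp only [α, β]
  omega

/-- Each chosen element of `G` is the sum of some prefix, and uniqueness of the zero-sum subsequence
rules out nearly all candidates. The survivors give relations that determine the parameters. -/
theorem eq_one_of_unique_pair [Finite G] {y z : G} {a b c d : ℕ} (ha : 1 ≤ a)
    (hc : 1 ≤ c) (hd : 1 ≤ d) (hdb : d < b) (hcard : Nat.card G = b + d + (a + c))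
    (hW : b • y + a • z = 0)
    (hu : ∀ i j : ℕ, i ≤ b + d → j ≤ a + c → i • y + j • z = 0 →
      (i = 0 ∧ j = 0) ∨ (i = b ∧ j = a)) : a = 1 ∧ addOrderOf y = Nat.card G := by
  have hcover := exists_prefix_eq_of_unique_pair hc hdb hcard hu
  have hgen : ∀ e : G, ∃ i j : ℤ, e = i • y + j • z := by
    intro e
    obtain ⟨i, j, h, -⟩ := hcover e
    exact ⟨i, j, by simpa using h⟩
  have hW' : (b : ℤ) • y + (a : ℤ) • z = 0 := by simpa using hW
  -- Forbidden relations `u • y + v • z = 0`: `key` treats one box, and the variants move it by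
  -- negation, by adding the relation of `W`, or by both.
  have key : ∀ u v : ℤ, u • y + v • z = 0 → 0 ≤ u → u ≤ b + d → 0 ≤ v → v ≤ a + c →
      (u = 0 ∧ v = 0) ∨ (u = b ∧ v = a) := by
    intro u v h h1 h2 h3 h4
    lift u to ℕ using h1
    lift v to ℕ using h3
    have := hu u v (by omega) (by omega) (by simpa using h)
    omega
  have key₂ : ∀ u v : ℤ, u • y + v • z = 0 → 0 ≤ -u → -u ≤ b + d → 0 ≤ -v → -v ≤ a + c →
      (-u = 0 ∧ -v = 0) ∨ (-u = b ∧ -v = a) := fun u v h => key _ _ (by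
    rw [neg_smul, neg_smul, ← neg_add, h, neg_zero])
  have key₃ : ∀ u v : ℤ, u • y + v • z = 0 → 0 ≤ u + b → u + b ≤ b + d → 0 ≤ v + a →
      v + a ≤ a + c → (u + b = 0 ∧ v + a = 0) ∨ (u + b = b ∧ v + a = a) := fun u v h => key _ _ (by
    rw [add_smul, add_smul, add_add_add_comm, h, hW', add_zero])
  have key₄ : ∀ u v : ℤ, u • y + v • z = 0 → 0 ≤ -u + b → -u + b ≤ b + d → 0 ≤ -v + a →
      -v + a ≤ a + c → (-u + b = 0 ∧ -v + a = 0) ∨ (-u + b = b ∧ -v + a = a) :=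
    fun u v h => key₃ _ _ (by rw [neg_smul, neg_smul, ← neg_add, h, neg_zero])
  have cover : ∀ p q : ℤ, ∃ i j : ℤ, (i - p) • y + (j - q) • z = 0 ∧
      ((j = 0 ∧ 1 ≤ i ∧ i ≤ b) ∨ (i = b ∧ 0 ≤ j ∧ j ≤ a + c) ∨
        (j = a + c ∧ b ≤ i ∧ i ≤ b + d)) := by
    intro p q
    obtain ⟨i, j, h, h'⟩ := hcover (p • y + q • z)
    refine ⟨i, j, ?_, by omega⟩
    rw [sub_smul, sub_smul, natCast_zsmul, natCast_zsmul]
    calc _ = (i • y + j • z) - (p • y + q • z) := by abel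
      _ = 0 := by rw [h, sub_self]
  have nz : ∀ k : ℤ, 0 ≤ k → k ≤ b → (-k) • y + (1 : ℤ) • z ≠ 0 := by
    intro k hk hk' h
    have := key₃ _ _ h
    omega
  -- For `y + z` only the prefix with `(b + 1, a + c)` survives; the difference `(b, a + c - 1)`
  -- must be `(b, a)`.
  have hc1 : c = 1 := by
    obtain ⟨i, j, h, hij⟩ := cover 1 1
    have h1 := key _ _ h
    have h2 := key₂ _ _ h
    have h3 := key₃ _ _ h
    have h4 := key₄ _ _ h
    omega
  subst hc1
  by_cases ha1 : a = 1
  · refine ⟨ha1, addOrderOf_eq_card_of_closure_pair (m := -b) ?_ hgen⟩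
    subst ha1
    rw [neg_smul]
    exact eq_neg_of_add_eq_zero_right (by simpa using hW)
  exfalso
  -- Here `(b + 1) • y = b • y + (a + 1) • z` is the only option; subtracting the relation of `W`
  -- isolates `z`.
  have hzb : z = ((b : ℤ) + 1) • y := by
    obtain ⟨i, j, h, hij⟩ := cover (b + 1) 0
    have h1 := key _ _ h
    have h2 := key₂ _ _ h
    have h3 := key₃ _ _ h
    have h4 := key₄ _ _ h
    obtain ⟨rfl, rfl⟩ : i = b ∧ j = a + 1 := by omega
    rw [sub_zero, sub_smul, add_smul (a : ℤ), one_smul] at h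
    rw [← sub_eq_zero, ← h]
    calc z - ((b : ℤ) + 1) • y = z - ((b : ℤ) + 1) • y + 0 := (add_zero _).symm
      _ = _ := by rw [← hW']; abel
  have hbd : b = d + 1 := by
    obtain ⟨i, j, h, hij⟩ := cover (d + 1) 1
    have h1 := key _ _ h
    have h2 := key₂ _ _ h
    have h3 := key₃ _ _ h
    have h4 := key₄ _ _ h
    omega
  obtain ⟨k, hk0, hkb, hk⟩ : ∃ k : ℤ, 1 ≤ k ∧ k + 1 ≤ b ∧ (-k) • y + (2 : ℤ) • z = 0 := by
    obtain ⟨i, j, h, hij⟩ := cover 1 2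
    have h1 := key _ _ h
    have h2 := key₂ _ _ h
    have h3 := key₃ _ _ h
    have h4 := key₄ _ _ h
    obtain ⟨rfl, hi⟩ : j = 0 ∧ 2 ≤ i ∧ i ≤ b := by omega
    refine ⟨i - 1, by omega, by omega, ?_⟩
    rw [neg_smul, ← neg_eq_zero, ← h, zero_sub, neg_smul, neg_add, neg_neg]
  have hord := addOrderOf_eq_card_of_closure_pair hzb hgen
  -- Combines `2 • z = k • y` with `z = (b + 1) • y`. Since `|G| = 2 * b + a` and `k ≥ 1`,
  -- divisibility forces `a ≤ 1`.
  have hdvd : ((addOrderOf y : ℕ) : ℤ) ∣ 2 * b + 2 - k := by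
    rw [addOrderOf_dvd_iff_zsmul_eq_zero, ← hk, hzb, ← mul_smul, ← add_smul]
    congr 1
    ring
  have := Int.le_of_dvd (by omega) hdvd
  rw [hord, hcard] at this
  omega

end TwoElements

/-! ### Classification of unique zero-sum subsequences -/

section Classification

variable {G : Type*} [AddCommGroup G]

theorem IsUniqueZeroSum.eq_replicate_addOrderOf [Finite G] {T : Multiset G} {x : G} {l : ℕ}
    (h : IsUniqueZeroSum T (Multiset.replicate l x)) :
    l = addOrderOf x := by
  obtain ⟨hle, h0, hs, hu⟩ := h
  have hl : 0 < l := by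
    rcases Nat.eq_zero_or_pos l with rfl | h
    · simp at h0
    · exact h
  rw [Multiset.sum_replicate, ← addOrderOf_dvd_iff_nsmul_eq_zero] at hs
  have hpos := addOrderOf_pos x
  have := hu (Multiset.replicate (addOrderOf x) x)
    (((Multiset.replicate_le_replicate x).2 (Nat.le_of_dvd hl hs)).trans hle)
    (by rw [Ne, ← Multiset.card_eq_zero, Multiset.card_replicate]; omega) (by simp [addOrderOf_nsmul_eq_zero])
  simpa using (congrArg Multiset.card this).symm

theorem IsUniqueZeroSum.addOrderOf_of_replicate [Finite G] {T : Multiset G} {x : G}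
    {l : ℕ} (hT : Multiset.card T = Nat.card G) (h : IsUniqueZeroSum T (Multiset.replicate l x)) :
    addOrderOf x = 1 ∨ 2 * addOrderOf x = Nat.card G ∨ addOrderOf x = Nat.card G := by
  classical
  obtain rfl := h.eq_replicate_addOrderOf
  have hnle := h.not_le_sub
  obtain ⟨hle, h0, hs, hu⟩ := h
  have hpos := addOrderOf_pos x
  have hcount : T.count x < 2 * addOrderOf x := by
    rw [← Multiset.le_count_iff_replicate_le, Multiset.count_sub, Multiset.count_replicate_self]
      at hnle
    omega
  have hcount' : addOrderOf x ≤ T.count x := Multiset.le_count_iff_replicate_le.2 hle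
  set V := T.filter (fun v => ¬ v = x) with hV
  have hTV : T = Multiset.replicate (T.count x) x + V := by
    conv_lhs => rw [← Multiset.filter_add_not (fun v => v = x) T]
    refine congrArg (· + V) ?_
    convert Multiset.filter_eq' T x
  have hcardV : Multiset.card T = T.count x + Multiset.card V := by
    conv_lhs => rw [hTV]
    simp
  have hquot : Nat.card G = Nat.card (G ⧸ AddSubgroup.zmultiples x) * addOrderOf x := by
    rw [← Nat.card_zmultiples]
    exact AddSubgroup.card_eq_card_quotient_mul_card_addSubgroup _
  -- A subsequence of `V` with sum in `⟨x⟩` could be completed by fewer than `addOrderOf x` copies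
  -- of `x` to a second zero-sum subsequence.
  have hVlt : Multiset.card V < Nat.card (G ⧸ AddSubgroup.zmultiples x) := by
    by_contra! hge
    obtain ⟨S, hSV, hS0, hS⟩ := exists_le_map_sum_eq_zero
      (QuotientAddGroup.mk' (AddSubgroup.zmultiples x)) V hge
    rw [QuotientAddGroup.mk'_apply, QuotientAddGroup.eq_zero_iff, ← neg_mem_iff,
      mem_zmultiples_iff_mem_range_addOrderOf] at hS
    simp only [Finset.mem_image, Finset.mem_range] at hS
    obtain ⟨j, hj, hj'⟩ := hS
    have h1 := hu (Multiset.replicate j x + S) ?_ ?_ ?_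
    · obtain ⟨s, hs⟩ := Multiset.exists_mem_of_ne_zero hS0
      have h2 : s ∈ Multiset.replicate (addOrderOf x) x := by
        rw [← h1]
        exact Multiset.mem_add.2 (Or.inr hs)
      have h3 := Multiset.mem_of_le hSV hs
      rw [hV, Multiset.mem_filter] at h3
      exact h3.2 (Multiset.eq_of_mem_replicate h2)
    · rw [hTV]
      exact add_le_add ((Multiset.replicate_le_replicate x).2 (by omega)) hSV
    · intro h
      exact hS0 (add_eq_zero.1 h).2
    · simp [hj']
  set k := Nat.card (G ⧸ AddSubgroup.zmultiples x)
  -- The bounds on the two parts of `T` amount to `(k - 2) * (addOrderOf x - 1) ≤ 0`, so `k ≤ 2` or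
  -- `x = 0`.
  rcases Nat.lt_or_ge k 3 with hk | hk
  · interval_cases k <;> omega
  · left
    by_contra hne
    obtain ⟨r, hr⟩ : ∃ r, addOrderOf x = r + 2 := ⟨addOrderOf x - 2, by omega⟩
    obtain ⟨s, hs⟩ : ∃ s, k = s + 3 := ⟨k - 3, by omega⟩
    rw [hr, hs] at hquot
    rw [hr] at hcount
    have h5 : (s + 3) * (r + 2) = s * r + 2 * s + 3 * r + 6 := by ring
    have := Nat.zero_le (s * r)
    omega

/-- Constant sequences of full or half length, and the sequences `g ^ k * (-kg)`. -/
def IsExtremalZeroSum (W : Multiset G) : Prop :=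
  (∃ a : G, (addOrderOf a = 1 ∨ 2 * addOrderOf a = Nat.card G ∨ addOrderOf a = Nat.card G) ∧
    W = Multiset.replicate (addOrderOf a) a) ∨
  ∃ (g : G) (k : ℕ), addOrderOf g = Nat.card G ∧ 1 ≤ k ∧ k + 2 ≤ Nat.card G ∧
    W = Multiset.replicate k g + {-(k • g)}

theorem IsUniqueZeroSum.isExtremal_of_notMem_sub [Finite G] [DecidableEq G] (hn : 3 ≤ Nat.card G)
    {T W : Multiset G} (hT : Multiset.card T = Nat.card G) (h : IsUniqueZeroSum T W) {x : G}
    (hx : x ∈ W) (hx' : x ∉ T - W) : IsExtremalZeroSum W := by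
  obtain ⟨hle, h0, hs, hu⟩ := h
  have hxT := Multiset.mem_of_le hle hx
  -- `W` uses every copy of `x` in `T`, so erasing one destroys the only zero-sum subsequence; the
  -- rest, of length `|G| - 1`, is constant.
  have hfree : ∀ V ≤ T.erase x, V ≠ 0 → V.sum ≠ 0 := by
    intro V hV hV0 hVs
    obtain rfl := hu V (hV.trans (Multiset.erase_le x T)) hV0 hVs
    have h1 := Multiset.count_le_of_le x hV
    have h2 := Multiset.count_eq_zero.2 hx'
    have h3 := Multiset.count_pos.2 hx
    rw [Multiset.count_sub] at h2
    rw [Multiset.count_erase_self] at h1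
    omega
  have hcard : Multiset.card (T.erase x) + 1 = Nat.card G := by
    rw [← hT, Multiset.card_erase_add_one hxT]
  obtain ⟨g, hg⟩ : ∃ g, g ∈ T.erase x := by
    rw [← Multiset.card_pos_iff_exists_mem]
    omega
  have hrep : T.erase x = Multiset.replicate (Nat.card G - 1) g :=
    Multiset.eq_replicate.2 ⟨by omega, fun b hb => eq_of_zeroSumFree hcard hfree hb hg⟩
  have hord : addOrderOf g = Nat.card G := by
    refine le_antisymm (Nat.le_of_dvd (by omega) (addOrderOf_dvd_natCard g)) ?_
    by_contra! hlt
    have := addOrderOf_pos g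
    refine hfree (Multiset.replicate (addOrderOf g) g) ?_ ?_ ?_
    · rw [hrep]
      exact (Multiset.replicate_le_replicate g).2 (by omega)
    · rw [Ne, ← Multiset.card_eq_zero, Multiset.card_replicate]
      omega
    · simp [addOrderOf_nsmul_eq_zero]
  obtain ⟨k, hk, hk'⟩ : ∃ k, k ≤ Nat.card G - 1 ∧ W.erase x = Multiset.replicate k g := by
    have h1 := Multiset.erase_le_erase x hle
    rw [hrep] at h1
    obtain ⟨k, hk, h2⟩ := Multiset.le_replicate_iff.1 h1
    exact ⟨k, hk, h2⟩
  have hW : W = x ::ₘ Multiset.replicate k g := by rw [← hk', Multiset.cons_erase hx]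
  have hxk : x = -(k • g) := by
    rw [hW, Multiset.sum_cons, Multiset.sum_replicate] at hs
    exact eq_neg_of_add_eq_zero_left hs
  rcases Nat.eq_zero_or_pos k with rfl | hk0
  · refine Or.inl ⟨0, Or.inl (by simp), ?_⟩
    rw [hW, hxk]
    simp
  rcases Nat.lt_or_ge (k + 1) (Nat.card G) with hk1 | hk1
  · refine Or.inr ⟨g, k, hord, hk0, hk1, ?_⟩
    rw [hW, hxk, add_comm, Multiset.singleton_add]
  · refine Or.inl ⟨g, Or.inr (Or.inr hord), ?_⟩
    have hxg : x = g := by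
      rw [hxk, neg_eq_iff_add_eq_zero, ← succ_nsmul, ← addOrderOf_dvd_iff_nsmul_eq_zero, hord]
      exact ⟨1, by omega⟩
    rw [hW, hxg, ← Multiset.replicate_succ, hord]
    congr 1
    omega

theorem IsUniqueZeroSum.isExtremal [Finite G] (hn : 3 ≤ Nat.card G) {T W : Multiset G}
    (hT : Multiset.card T = Nat.card G) (h : IsUniqueZeroSum T W) : IsExtremalZeroSum W := by
  classical
  by_cases hconst : ∃ w, ∀ x ∈ W, x = w
  · obtain ⟨w, hw⟩ := hconst
    have hW : W = Multiset.replicate (Multiset.card W) w := Multiset.eq_replicate.2 ⟨rfl, hw⟩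
    rw [hW] at h
    have h1 := h.eq_replicate_addOrderOf
    exact Or.inl ⟨w, h.addOrderOf_of_replicate hT, by rw [← h1, ← hW]⟩
  push Not at hconst
  by_cases hγ : ∃ x ∈ W, x ∉ T - W
  · obtain ⟨x, hx, hx'⟩ := hγ
    exact h.isExtremal_of_notMem_sub hn hT hx hx'
  push Not at hγ
  obtain ⟨y, hy⟩ : ∃ y, (T - W).count y < W.count y := by
    have := h.not_le_sub
    rw [Multiset.le_iff_count] at this
    simpa using this
  have hyW : y ∈ W := Multiset.count_pos.1 (by omega)
  obtain ⟨z, hzW, hzy⟩ := hconst y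
  -- Two distinct terms of `W` other than `v` would give `|T| < |G|`. Hence `y` and `z` are the only
  -- terms of `T`.
  have hpair : ∀ v ∈ T - W, v ≠ y → ∀ x ∈ W, x ≠ v → x = y := by
    intro v hv hvy x hx hxv
    by_contra hxy
    have := h.card_add_one_le hv hvy.symm hy hx hyW hxv hvy.symm hxy
    omega
  have hWyz : ∀ x ∈ W, x = y ∨ x = z := by
    intro x hx
    by_contra! hne
    exact hne.1 (hpair z (hγ z hzW) hzy x hx hne.2)
  have hUyz : ∀ x ∈ T - W, x = y ∨ x = z := by
    intro x hx
    by_contra! hne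
    exact hzy (hpair x hx hne.1 z hzW hne.2.symm)
  have hrep : ∀ S : Multiset G, (∀ x ∈ S, x = y ∨ x = z) →
      S = Multiset.replicate (S.count y) y + Multiset.replicate (S.count z) z := by
    intro S hS
    ext v
    rw [Multiset.count_add, Multiset.count_replicate, Multiset.count_replicate]
    by_cases hv : v ∈ S
    · rcases hS v hv with rfl | rfl
      · simp [hzy]
      · simp [hzy.symm]
    · rw [Multiset.count_eq_zero.2 hv]
      split_ifs with h1 h2 h2 <;> simp_all
  have hWr := hrep W hWyz
  have hUr := hrep (T - W) hUyz
  have hTWU : T = W + (T - W) := (add_tsub_cancel_of_le h.1).symm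
  have hd := Multiset.count_pos.2 (hγ y hyW)
  have hc := Multiset.count_pos.2 (hγ z hzW)
  have ha := Multiset.count_pos.2 hzW
  generalize (T - W).count y = d at *
  generalize (T - W).count z = c at *
  generalize hb : W.count y = b at *
  generalize ha' : W.count z = a at *
  rw [hUr, hWr] at hTWU
  have hTr : T = Multiset.replicate (b + d) y + Multiset.replicate (a + c) z := by
    rw [hTWU, Multiset.replicate_add, Multiset.replicate_add]
    exact add_add_add_comm _ _ _ _
  have hcard : Nat.card G = b + d + (a + c) := by
    rw [← hT, hTr]
    simp
  have hWs := h.2.2.1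
  rw [hWr] at hWs
  simp only [Multiset.sum_add, Multiset.sum_replicate] at hWs
  obtain ⟨ha1, hord⟩ := eq_one_of_unique_pair ha hc hd hy hcard hWs (by
    intro i j hi hj hij
    by_cases h0 : i = 0 ∧ j = 0
    · exact Or.inl h0
    · right
      have h1 := h.2.2.2 (Multiset.replicate i y + Multiset.replicate j z) ?_ ?_ ?_
      · rw [← hb, ← ha', ← h1]
        simp [Multiset.count_replicate, hzy, hzy.symm]
      · rw [hTr]
        exact add_le_add ((Multiset.replicate_le_replicate y).2 hi)
          ((Multiset.replicate_le_replicate z).2 hj)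
      · rw [Ne, ← Multiset.card_eq_zero]
        simp only [Multiset.card_add, Multiset.card_replicate]
        omega
      · simpa using hij)
  refine Or.inr ⟨y, b, hord, by omega, by omega, ?_⟩
  rw [hWr, ha1, Multiset.replicate_one]
  congr 2
  rw [ha1, one_smul] at hWs
  exact eq_neg_of_add_eq_zero_right hWs

theorem IsUniqueZeroSum.eq_replicate_of_card_lt [Finite G] {T W : Multiset G}
    (hT : Nat.card G < Multiset.card T) (h : IsUniqueZeroSum T W) :
    ∃ x, T = Multiset.replicate (Multiset.card T) x := by
  classical
  obtain ⟨y, hy⟩ : ∃ y, (T - W).count y < W.count y := by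
    have := h.not_le_sub
    rw [Multiset.le_iff_count] at this
    simpa using this
  have hTWU : T = W + (T - W) := (add_tsub_cancel_of_le h.1).symm
  have hU : ∀ z ∈ T - W, z = y := by
    intro z hz
    by_contra hzy
    have := h.card_le hz (Ne.symm hzy) hy
    omega
  refine ⟨y, Multiset.eq_replicate.2 ⟨rfl, fun x hx => ?_⟩⟩
  rw [hTWU, Multiset.mem_add] at hx
  rcases hx with hx | hx
  swap
  · exact hU x hx
  by_contra hxy
  rcases Multiset.empty_or_exists_mem (T - W) with h0 | ⟨v, hv⟩
  · rw [h0, add_zero] at hTWU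
    have hlt : Nat.card G ≤ Multiset.card (T.erase x) := by
      rw [Multiset.card_erase_of_mem (hTWU ▸ hx)]
      exact Nat.le_pred_of_lt hT
    obtain ⟨V, hV, hV0, hVs⟩ := exists_le_sum_eq_zero _ hlt
    have h1 := h.2.2.2 V (hV.trans (Multiset.erase_le x T)) hV0 hVs
    rw [h1, ← hTWU] at hV
    exact absurd (Multiset.card_le_card hV) (not_le.2 (Multiset.card_erase_lt_of_mem (hTWU ▸ hx)))
  · obtain rfl := hU v hv
    -- Now `x` can play the role of `y`: it occurs in `W` but not in `T - W`, whose terms all equal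
    -- `v`.
    have hx0 : (T - W).count x = 0 := Multiset.count_eq_zero.2 fun hmem => hxy (hU x hmem)
    have := h.card_le hv hxy (hx0 ▸ Multiset.count_pos.2 hx)
    omega

end Classification

/-! ### Witnesses for membership and sets `Ω` for non-membership -/

section Invariant

theorem universalInvariant_eq {G : Type*} {Ω : Set (Multiset G)} {t : ℕ} (ht : 0 < t)
    (h : ∀ T : Multiset G, Multiset.card T = t → ∃ W, W ≤ T ∧ W ∈ Ω)
    {S : Multiset G} (hS : Multiset.card S + 1 = t) (hSΩ : ∀ W ≤ S, W ∉ Ω) :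
    universalInvariant Ω = (t : ℕ∞) := by
  refine le_antisymm (sInf_le ⟨t, rfl, ht, h⟩) (le_sInf ?_)
  rintro d ⟨l, rfl, hl, hl'⟩
  rw [Nat.cast_le]
  by_contra! hlt
  obtain ⟨W, hW, hWΩ⟩ := hl' (S.toList.take l : Multiset G) (by simp; omega)
  refine hSΩ W (hW.trans ?_) hWΩ
  conv_rhs => rw [← S.coe_toList]
  exact Multiset.coe_le.2 (List.take_sublist _ _).subperm

theorem exists_le_of_universalInvariant_eq {G : Type*} {Ω : Set (Multiset G)} {t : ℕ}
    (h : universalInvariant Ω = (t : ℕ∞)) (T : Multiset G) (hT : Multiset.card T = t) :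
    ∃ W, W ≤ T ∧ W ∈ Ω := by
  have hne : {d : ℕ∞ | ∃ l : ℕ, d = (l : ℕ∞) ∧ 0 < l ∧
      ∀ T : Multiset G, Multiset.card T = l → ∃ W, W ≤ T ∧ W ∈ Ω}.Nonempty := by
    by_contra hemp
    rw [Set.not_nonempty_iff_eq_empty] at hemp
    rw [universalInvariant, hemp, sInf_empty] at h
    exact ENat.natCast_ne_top t h.symm
  have hmem := csInf_mem hne
  rw [show sInf _ = (t : ℕ∞) from h] at hmem
  obtain ⟨l, hl, -, hl'⟩ := hmem
  exact hl' T (hT.trans (Nat.cast_injective hl))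

theorem zero_notMem_of_universalInvariant_eq {G : Type*} {Ω : Set (Multiset G)} {t : ℕ}
    (ht : 2 ≤ t) (h : universalInvariant Ω = (t : ℕ∞)) : (0 : Multiset G) ∉ Ω := by
  intro h0
  have : universalInvariant Ω ≤ ((1 : ℕ) : ℕ∞) :=
    sInf_le ⟨1, rfl, one_pos, fun T _ => ⟨0, Multiset.zero_le T, h0⟩⟩
  rw [h, Nat.cast_le] at this
  omega

variable {G : Type*} [AddCommGroup G]

theorem IsUniqueZeroSum.mem_Qset {T W : Multiset G} {t : ℕ} (h : IsUniqueZeroSum T W) (ht : 2 ≤ t)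
    (hT : Multiset.card T = t) : W ∈ Qset G t := by
  rintro Ω ⟨hΩ, hinv⟩
  obtain ⟨V, hV, hVΩ⟩ := exists_le_of_universalInvariant_eq hinv T hT
  have hV0 : V ≠ 0 := fun h0 => zero_notMem_of_universalInvariant_eq ht hinv (h0 ▸ hVΩ)
  rwa [← h.2.2.2 V hV hV0 (hΩ hVΩ)]

theorem notMem_Qset {Ω : Set (Multiset G)} {t : ℕ} {W : Multiset G} (ht : 0 < t)
    (hΩ : Ω ⊆ zeroSumSequences G) (hW : W ∉ Ω)
    (h : ∀ T : Multiset G, Multiset.card T = t → ¬ ∀ V ≤ T, V ∉ Ω)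
    {S : Multiset G} (hS : Multiset.card S + 1 = t) (hSΩ : ∀ V ≤ S, V ∉ Ω) : W ∉ Qset G t := by
  intro hQ
  refine hW (hQ Ω ⟨hΩ, universalInvariant_eq ht (fun T hT => ?_) hS hSΩ⟩)
  have := h T hT
  push Not at this
  exact this

theorem exists_eq_replicate_add_of_le {α : Type*} {m m' : ℕ} {x y : α} {V : Multiset α}
    (h : V ≤ Multiset.replicate m x + Multiset.replicate m' y) :
    ∃ i j, i ≤ m ∧ j ≤ m' ∧ V = Multiset.replicate i x + Multiset.replicate j y := by
  classical
  obtain ⟨i, hi, h1⟩ := Multiset.le_replicate_iff.1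
    (Multiset.inter_le_right (s := V) (t := Multiset.replicate m x))
  obtain ⟨j, hj, h2⟩ := Multiset.le_replicate_iff.1 (tsub_le_iff_left.2 h)
  exact ⟨i, j, hi, hj, by rw [← h1, ← h2, add_comm, Multiset.sub_add_inter]⟩

theorem isUniqueZeroSum_replicate [Finite G] {g : G} {t : ℕ} (h : addOrderOf g ≤ t)
    (h' : t < 2 * addOrderOf g) :
    IsUniqueZeroSum (Multiset.replicate t g) (Multiset.replicate (addOrderOf g) g) := by
  have hpos := addOrderOf_pos g
  refine ⟨(Multiset.replicate_le_replicate g).2 h, ?_, by simp [addOrderOf_nsmul_eq_zero], ?_⟩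
  · rw [Ne, ← Multiset.card_eq_zero, Multiset.card_replicate]
    omega
  · intro V hV hV0 hVs
    obtain ⟨i, hi, rfl⟩ := Multiset.le_replicate_iff.1 hV
    rw [Multiset.sum_replicate, ← addOrderOf_dvd_iff_nsmul_eq_zero] at hVs
    obtain ⟨k, rfl⟩ := hVs
    have h1 : k < 2 := by
      by_contra! hk
      have := Nat.mul_le_mul_left (addOrderOf g) hk
      omega
    interval_cases k
    · simp at hV0
    · rw [mul_one]

theorem isUniqueZeroSum_replicate_add_neg [Finite G] {g : G} {k : ℕ}
    (hk : k + 1 ≤ addOrderOf g) :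
    IsUniqueZeroSum (Multiset.replicate (addOrderOf g - 1) g + Multiset.replicate 1 (-(k • g)))
      (Multiset.replicate k g + {-(k • g)}) := by
  have hpos := addOrderOf_pos g
  refine ⟨?_, by simp, by simp, ?_⟩
  · rw [Multiset.replicate_one]
    gcongr
    omega
  intro V hV hV0 hVs
  obtain ⟨i, j, hi, hj, rfl⟩ := exists_eq_replicate_add_of_le hV
  rw [Multiset.sum_add, Multiset.sum_replicate, Multiset.sum_replicate] at hVs
  interval_cases j
  · rw [zero_smul, add_zero, ← addOrderOf_dvd_iff_nsmul_eq_zero] at hVs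
    rcases Nat.eq_zero_or_pos i with rfl | hi0
    · simp at hV0
    · have := Nat.le_of_dvd hi0 hVs
      omega
  · rw [one_smul, ← sub_eq_add_neg, sub_eq_zero] at hVs
    rw [nsmul_injOn_Iio_addOrderOf (show i < addOrderOf g by omega)
      (show k < addOrderOf g by omega) hVs, Multiset.replicate_one]

theorem isUniqueZeroSum_replicate_add_singleton [Finite G] {a b : G}
    (hb : b ∉ AddSubgroup.zmultiples a) :
    IsUniqueZeroSum (Multiset.replicate (2 * addOrderOf a - 1) a + Multiset.replicate 1 b)
      (Multiset.replicate (addOrderOf a) a) := by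
  have hpos := addOrderOf_pos a
  obtain ⟨hle, h0, hs, hu⟩ := isUniqueZeroSum_replicate (g := a) (t := 2 * addOrderOf a - 1)
    (by omega) (by omega)
  refine ⟨hle.trans (Multiset.le_add_right _ _), h0, hs, ?_⟩
  intro V hV hV0 hVs
  obtain ⟨i, j, hi, hj, rfl⟩ := exists_eq_replicate_add_of_le hV
  interval_cases j
  · rw [Multiset.replicate_zero, add_zero] at hV0 hVs ⊢
    exact hu _ ((Multiset.replicate_le_replicate a).2 hi) hV0 hVs
  · rw [Multiset.sum_add, Multiset.sum_replicate, Multiset.sum_replicate, one_smul] at hVs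
    refine absurd ?_ hb
    rw [eq_neg_of_add_eq_zero_right hVs]
    exact neg_mem (nsmul_mem (AddSubgroup.mem_zmultiples a) i)

theorem IsExtremalZeroSum.mem_Qset [Finite G] {g : G} (hg : addOrderOf g = Nat.card G)
    (hn : 3 ≤ Nat.card G) {W : Multiset G} (hW : IsExtremalZeroSum W) :
    W ∈ Qset G (Nat.card G) := by
  rcases hW with ⟨a, ha | ha | ha, rfl⟩ | ⟨g, k, hg, hk, hk', rfl⟩
  · have := isUniqueZeroSum_replicate_add_neg (g := g) (k := 0) (by omega)
    rw [AddMonoid.addOrderOf_eq_one_iff] at ha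
    subst ha
    simpa using this.mem_Qset (t := Nat.card G) (by omega) (by simp; omega)
  · refine (isUniqueZeroSum_replicate_add_singleton (b := g) fun hmem => ?_).mem_Qset
      (by omega) (by simp; omega)
    have := Nat.le_of_dvd (addOrderOf_pos a) (addOrderOf_dvd_of_mem_zmultiples hmem)
    omega
  · exact (isUniqueZeroSum_replicate (g := a) (t := Nat.card G) (by omega) (by omega)).mem_Qset
      (by omega) (by simp)
  · exact (isUniqueZeroSum_replicate_add_neg (g := g) (k := k) (by omega)).mem_Qset
      (by omega) (by simp; omega)

theorem isExtremalZeroSum_of_mem_Qset [Finite G] {g : G} (hg : addOrderOf g = Nat.card G)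
    (hn : 3 ≤ Nat.card G) {W : Multiset G} (hW : W ∈ Qset G (Nat.card G)) :
    IsExtremalZeroSum W := by
  by_contra hex
  refine notMem_Qset (Ω := {V | V.sum = 0 ∧ V ≠ 0 ∧ V ≠ W}) (by omega) (fun V hV => hV.1)
    (fun h => h.2.2 rfl) ?_ (S := Multiset.replicate (Nat.card G - 1) g) (by simp; omega) ?_ hW
  · intro T hT hcon
    have huniq : ∀ V ≤ T, V ≠ 0 → V.sum = 0 → V = W := by
      intro V hV hV0 hVs
      by_contra hVW
      exact hcon V hV ⟨hVs, hV0, hVW⟩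
    obtain ⟨V, hV, hV0, hVs⟩ := exists_le_sum_eq_zero T hT.ge
    obtain rfl := huniq V hV hV0 hVs
    exact hex (IsUniqueZeroSum.isExtremal hn hT ⟨hV, hV0, hVs, huniq⟩)
  · rintro V hV ⟨hVs, hV0, -⟩
    obtain ⟨i, hi, rfl⟩ := Multiset.le_replicate_iff.1 hV
    rw [Multiset.sum_replicate, ← addOrderOf_dvd_iff_nsmul_eq_zero, hg] at hVs
    rcases Nat.eq_zero_or_pos i with rfl | hi0
    · simp at hV0
    · have := Nat.le_of_dvd hi0 hVs
      omega

theorem card_filter_ne_add_count {α : Type*} [DecidableEq α] (T : Multiset α) (x : α) :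
    Multiset.card (T.filter (· ≠ x)) + T.count x = Multiset.card T := by
  conv_rhs => rw [← Multiset.filter_add_not (· = x) T, Multiset.card_add, Multiset.filter_eq',
    Multiset.card_replicate]
  exact add_comm _ _

/-- Powers of `0` other than `0 ^ (t - n + 1)` are left out of `Ω`, so that `g ^ (n - 1) * 0 ^ (t -
n)` avoids it. A sequence `T` avoiding `Ω` has at least `n` nonzero terms, hence contains `W` with
nonzero terms. Were `0` in `T`, then `0 * W` would be a further member of `Ω`; so `W` is unique in
`T`, and `T` is constant. -/
theorem notMem_Qset_of_ne_replicate_zero [Finite G] {g : G} (hg : addOrderOf g = Nat.card G)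
    (hn : 3 ≤ Nat.card G) {t : ℕ} (ht : Nat.card G + 1 ≤ t) {W : Multiset G}
    (hW0 : W ≠ Multiset.replicate (t - Nat.card G + 1) 0)
    (hW : ∀ a : G, W = Multiset.replicate (addOrderOf a) a → 2 * addOrderOf a ≤ t) :
    W ∉ Qset G t := by
  classical
  have hg0 : g ≠ 0 := by
    rintro rfl
    rw [addOrderOf_zero] at hg
    omega
  refine notMem_Qset (Ω := {V | V = Multiset.replicate (t - Nat.card G + 1) 0 ∨
    (V.sum = 0 ∧ (∃ v ∈ V, v ≠ 0) ∧ V ≠ W)}) (by omega) ?_ ?_ ?_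
    (S := Multiset.replicate (Nat.card G - 1) g + Multiset.replicate (t - Nat.card G) 0)
    (by simp; omega) ?_
  · rintro V (rfl | hV)
    · simp [zeroSumSequences]
    · exact hV.1
  · rintro (h | h)
    · exact hW0 h
    · exact h.2.2 rfl
  · intro T hT hcon
    have hcount : T.count 0 ≤ t - Nat.card G := by
      by_contra! hlt
      exact hcon _ (Multiset.le_count_iff_replicate_le.1 hlt) (Or.inl rfl)
    have huniq : ∀ V ≤ T, V.sum = 0 → (∃ v ∈ V, v ≠ 0) → V = W := by
      intro V hV hVs hv
      by_contra hVW
      exact hcon V hV (Or.inr ⟨hVs, hv, hVW⟩)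
    have hcard := card_filter_ne_add_count T 0
    obtain ⟨V, hV, hV0, hVs⟩ := exists_le_sum_eq_zero (T.filter (· ≠ 0)) (by omega)
    have hVT : V ≤ T := hV.trans (Multiset.filter_le _ _)
    obtain ⟨v, hv⟩ := Multiset.exists_mem_of_ne_zero hV0
    have hv0 : v ≠ 0 := by simpa using (Multiset.mem_filter.1 (Multiset.mem_of_le hV hv)).2
    obtain rfl := huniq V hVT hVs ⟨v, hv, hv0⟩
    by_cases h0 : (0 : G) ∈ T
    · have h1 : (0 : G) ∉ V := fun hmem => by
        simpa using (Multiset.mem_filter.1 (Multiset.mem_of_le hV hmem)).2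
      have h2 : 0 ::ₘ V ≤ T := by
        rw [← Multiset.cons_erase h0]
        refine Multiset.cons_le_cons 0 ((Multiset.le_cons_of_notMem h1).1 ?_)
        rwa [Multiset.cons_erase h0]
      have := huniq (0 ::ₘ V) h2 (by simpa using hVs)
        ⟨v, Multiset.mem_cons_of_mem hv, hv0⟩
      exact absurd (congrArg Multiset.card this) (by simp)
    · have hU : IsUniqueZeroSum T V := by
        refine ⟨hVT, hV0, hVs, fun S hS hS0 hSs => huniq S hS hSs ?_⟩
        obtain ⟨s, hs⟩ := Multiset.exists_mem_of_ne_zero hS0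
        exact ⟨s, hs, fun h => h0 (h ▸ Multiset.mem_of_le hS hs)⟩
      obtain ⟨x, hx⟩ := hU.eq_replicate_of_card_lt (by omega)
      have hVx : V = Multiset.replicate (Multiset.card V) x := by
        refine Multiset.eq_replicate.2 ⟨rfl, fun s hs => ?_⟩
        have := Multiset.mem_of_le hVT hs
        rw [hx] at this
        exact Multiset.eq_of_mem_replicate this
      have hcardV : Multiset.card V = addOrderOf x :=
        IsUniqueZeroSum.eq_replicate_addOrderOf (T := T) (hVx ▸ hU)
      have h2 := hW x (hcardV ▸ hVx)
      have hpos := addOrderOf_pos x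
      have h3 := hU.2.2.2 (Multiset.replicate (2 * addOrderOf x) x) ?_ ?_ ?_
      · have := congrArg Multiset.card h3
        rw [Multiset.card_replicate] at this
        omega
      · rw [hx, hT]
        exact (Multiset.replicate_le_replicate x).2 h2
      · rw [Ne, ← Multiset.card_eq_zero, Multiset.card_replicate]
        omega
      · rw [Multiset.sum_replicate, mul_smul, addOrderOf_nsmul_eq_zero, smul_zero]
  · rintro V hV (rfl | ⟨hVs, ⟨v, hv, hv0⟩, -⟩)
    · have := Multiset.count_le_of_le 0 hV
      simp [Multiset.count_replicate, hg0] at this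
    · obtain ⟨i, j, hi, hj, rfl⟩ := exists_eq_replicate_add_of_le hV
      simp only [Multiset.sum_add, Multiset.sum_replicate, smul_zero, add_zero] at hVs
      rw [← addOrderOf_dvd_iff_nsmul_eq_zero, hg] at hVs
      rcases Nat.eq_zero_or_pos i with rfl | hi0
      · rw [Multiset.replicate_zero, zero_add] at hv
        exact hv0 (Multiset.eq_of_mem_replicate hv)
      · have := Nat.le_of_dvd hi0 hVs
        omega

/-- The set `Ω` is thinned so that `g ^ (n - 1) * (-g) ^ (t - n)` avoids it. If a `T` of length `t`
avoided it, deleting all copies of `g`, or all of `-g`, would have to leave fewer than `n` terms.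
Both would then occur at least `t - n + 1` times, giving a zero-sum product not excluded from `Ω`.
-/
theorem replicate_zero_notMem_Qset_of_lt [Finite G] {g : G} (hg : addOrderOf g = Nat.card G)
    (hn : 3 ≤ Nat.card G) {t k : ℕ} (ht : Nat.card G ≤ t) (ht' : t < 2 * Nat.card G)
    (hk : 2 ≤ k) : Multiset.replicate k (0 : G) ∉ Qset G t := by
  classical
  have hg0 : g ≠ 0 := by
    rintro rfl
    rw [addOrderOf_zero] at hg
    omega
  have hgn : g ≠ -g := by
    intro h
    have h1 : 2 • g = 0 := by
      rw [two_nsmul]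
      exact add_eq_zero_iff_eq_neg.2 h
    have := Nat.le_of_dvd two_pos (addOrderOf_dvd_of_nsmul_eq_zero h1)
    omega
  refine notMem_Qset (Ω := {V | V = {0} ∨ (V.sum = 0 ∧ V ≠ 0 ∧ (0 : G) ∉ V ∧
    ∀ i ≤ t - Nat.card G, V ≠ Multiset.replicate i g + Multiset.replicate i (-g))}) (by omega)
    ?_ ?_ ?_
    (S := Multiset.replicate (Nat.card G - 1) g + Multiset.replicate (t - Nat.card G) (-g))
    (by simp; omega) ?_
  · rintro V (rfl | hV)
    · simp [zeroSumSequences]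
    · exact hV.1
  · rintro (h | h)
    · have := congrArg Multiset.card h
      simp at this
      omega
    · exact h.2.2.1 (Multiset.mem_replicate.2 ⟨by omega, rfl⟩)
  · intro T hT hcon
    have h0T : (0 : G) ∉ T := fun h => hcon {0} (Multiset.singleton_le.2 h) (Or.inl rfl)
    have huniq : ∀ V ≤ T, V.sum = 0 → V ≠ 0 → ∃ i ≤ t - Nat.card G,
        V = Multiset.replicate i g + Multiset.replicate i (-g) := by
      intro V hV hVs hV0
      by_contra! hne
      exact hcon V hV (Or.inr ⟨hVs, hV0, fun h => h0T (Multiset.mem_of_le hV h), hne⟩)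
    have hcount : ∀ x, (x = g ∨ x = -g) → t - Nat.card G + 1 ≤ T.count x := by
      intro x hx
      by_contra! hlt
      have hcard := card_filter_ne_add_count T x
      obtain ⟨V, hV, hV0, hVs⟩ := exists_le_sum_eq_zero (T.filter (· ≠ x)) (by omega)
      obtain ⟨i, -, rfl⟩ := huniq V (hV.trans (Multiset.filter_le _ _)) hVs hV0
      have hi : i ≠ 0 := by
        rintro rfl
        simp at hV0
      have hmem : x ∈ Multiset.replicate i g + Multiset.replicate i (-g) := by
        rcases hx with rfl | rfl
        · exact Multiset.mem_add.2 (Or.inl (Multiset.mem_replicate.2 ⟨hi, rfl⟩))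
        · exact Multiset.mem_add.2 (Or.inr (Multiset.mem_replicate.2 ⟨hi, rfl⟩))
      simpa using (Multiset.mem_filter.1 (Multiset.mem_of_le hV hmem)).2
    have h1 := hcount g (Or.inl rfl)
    have h2 := hcount (-g) (Or.inr rfl)
    have hle : Multiset.replicate (t - Nat.card G + 1) g +
        Multiset.replicate (t - Nat.card G + 1) (-g) ≤ T := by
      rw [Multiset.le_iff_count]
      intro x
      rw [Multiset.count_add, Multiset.count_replicate, Multiset.count_replicate]
      split_ifs with h4 h5 h5
      · exact absurd (h4.trans h5.symm) hgn
      · subst h4; omega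
      · subst h5; omega
      · omega
    obtain ⟨i, hi, h3⟩ := huniq _ hle (by simp) (by simp)
    have := congrArg Multiset.card h3
    simp only [Multiset.card_add, Multiset.card_replicate] at this
    omega
  · rintro V hV (rfl | ⟨hVs, hV0, -, hVi⟩)
    · have := Multiset.mem_of_le hV (Multiset.mem_singleton_self 0)
      rw [Multiset.mem_add] at this
      rcases this with h | h
      · exact hg0 (Multiset.eq_of_mem_replicate h).symm
      · exact hg0 (neg_eq_zero.1 (Multiset.eq_of_mem_replicate h).symm)
    · obtain ⟨i, j, hi, hj, rfl⟩ := exists_eq_replicate_add_of_le hV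
      rw [Multiset.sum_add, Multiset.sum_replicate, Multiset.sum_replicate, smul_neg,
        ← sub_eq_add_neg, sub_eq_zero] at hVs
      have hij : i = j := nsmul_injOn_Iio_addOrderOf (show i < addOrderOf g by omega)
        (show j < addOrderOf g by omega) hVs
      subst hij
      exact hVi i hj rfl

/-- A sequence avoiding `Ω` has at least `2n` nonzero terms, hence two disjoint zero-sum
subsequences; one of them and their product cannot both equal `g ^ n`. -/
theorem replicate_zero_notMem_Qset_of_le [Finite G] {g : G} (hg : addOrderOf g = Nat.card G)
    (hn : 3 ≤ Nat.card G) {t k : ℕ} (ht : 2 * Nat.card G ≤ t) (hk0 : k ≠ 0)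
    (hk : k ≠ t - 2 * Nat.card G + 1) : Multiset.replicate k (0 : G) ∉ Qset G t := by
  classical
  have hg0 : g ≠ 0 := by
    rintro rfl
    rw [addOrderOf_zero] at hg
    omega
  refine notMem_Qset (Ω := {V | V = Multiset.replicate (t - 2 * Nat.card G + 1) 0 ∨
    (V.sum = 0 ∧ V ≠ 0 ∧ (0 : G) ∉ V ∧ V ≠ Multiset.replicate (Nat.card G) g)}) (by omega) ?_ ?_ ?_
    (S := Multiset.replicate (2 * Nat.card G - 1) g + Multiset.replicate (t - 2 * Nat.card G) 0)
    (by simp; omega) ?_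
  · rintro V (rfl | hV)
    · simp [zeroSumSequences]
    · exact hV.1
  · rintro (h | h)
    · exact hk (by simpa using congrArg Multiset.card h)
    · exact h.2.2.1 (Multiset.mem_replicate.2 ⟨hk0, rfl⟩)
  · intro T hT hcon
    have hcount : T.count 0 ≤ t - 2 * Nat.card G := by
      by_contra! hlt
      exact hcon _ (Multiset.le_count_iff_replicate_le.1 hlt) (Or.inl rfl)
    have hcard := card_filter_ne_add_count T 0
    set R := T.filter (· ≠ 0) with hR
    have huniq : ∀ V ≤ R, V ≠ 0 → V.sum = 0 → V = Multiset.replicate (Nat.card G) g := by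
      intro V hV hV0 hVs
      by_contra hne
      refine hcon V (hV.trans (Multiset.filter_le _ _)) (Or.inr ⟨hVs, hV0, fun h => ?_, hne⟩)
      simpa [hR] using Multiset.mem_of_le hV h
    obtain ⟨V, hV, hV0, hVs⟩ := exists_le_sum_eq_zero R (by omega)
    have hVg := huniq V hV hV0 hVs
    have hcardV : Multiset.card V = Nat.card G := by rw [hVg, Multiset.card_replicate]
    obtain ⟨V', hV', hV0', hVs'⟩ := exists_le_sum_eq_zero (R - V)
      (by rw [Multiset.card_sub hV]; omega)
    have hle : V + V' ≤ R := (add_le_add_right hV' V).trans_eq (add_tsub_cancel_of_le hV)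
    have h1 := huniq (V + V') hle (fun h => hV0 (add_eq_zero.1 h).1) (by simp [hVs, hVs'])
    rw [hVg] at h1
    exact hV0' (by simpa using h1)
  · rintro V hV (rfl | ⟨hVs, hV0, h0V, hVg⟩)
    · have := Multiset.count_le_of_le 0 hV
      simp [Multiset.count_replicate, hg0] at this
    · obtain ⟨i, j, hi, hj, rfl⟩ := exists_eq_replicate_add_of_le hV
      obtain rfl : j = 0 := by
        by_contra hj0
        exact h0V (Multiset.mem_add.2 (Or.inr (Multiset.mem_replicate.2 ⟨hj0, rfl⟩)))
      rw [Multiset.replicate_zero, add_zero] at hVs hV0 hVg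
      have hi0 : i ≠ 0 := by
        rintro rfl
        simp at hV0
      rw [Multiset.sum_replicate, ← addOrderOf_dvd_iff_nsmul_eq_zero, hg] at hVs
      have hin := Nat.le_of_dvd (Nat.pos_of_ne_zero hi0) hVs
      exact hVg (by rw [Nat.eq_of_dvd_of_lt_two_mul hi0 hVs (by omega)])

end Invariant

theorem theorem3p2 (G : Type*) [AddCommGroup G] [IsAddCyclic G] (n : ℕ)
    (hcard : Nat.card G = n) (hn : 3 ≤ n) :
    (Qset G n =
      {V | ∃ a : G, (addOrderOf a = 1 ∨ 2 * addOrderOf a = n ∨ addOrderOf a = n) ∧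
          V = Multiset.replicate (addOrderOf a) a} ∪
      {V | ∃ (g : G) (k : ℕ), addOrderOf g = n ∧ 1 ≤ k ∧ k + 2 ≤ n ∧
          V = Multiset.replicate k g + {-(k • g)}}) ∧
    (∀ t : ℕ, n + 1 ≤ t → t ≤ 2 * n - 1 →
      Qset G t = {V | ∃ a : G, addOrderOf a = n ∧ V = Multiset.replicate (addOrderOf a) a}) ∧
    (∀ t : ℕ, 2 * n ≤ t → Qset G t = ∅) := by
  subst hcard
  have : Finite G := Nat.finite_of_card_ne_zero (by omega)
  obtain ⟨g, hg⟩ := IsAddCyclic.exists_ofOrder_eq_natCard (α := G)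
  refine ⟨?_, fun t ht ht' => ?_, fun t ht => ?_⟩
  · ext W
    exact ⟨isExtremalZeroSum_of_mem_Qset hg hn, IsExtremalZeroSum.mem_Qset hg hn⟩
  · ext W
    constructor
    · intro hW
      by_contra hne
      have hW0 : W ≠ Multiset.replicate (t - Nat.card G + 1) 0 := by
        rintro rfl
        exact replicate_zero_notMem_Qset_of_lt hg hn (by omega) (by omega) (by omega) hW
      refine notMem_Qset_of_ne_replicate_zero hg hn ht hW0 (fun a ha => ?_) hW
      by_contra! hlt
      -- A divisor of `n` exceeding `n / 2` is `n` itself.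
      exact hne ⟨a, (Nat.eq_of_dvd_of_lt_two_mul (by omega)
        (addOrderOf_dvd_natCard a) (by omega)).symm, ha⟩
    · rintro ⟨a, ha, rfl⟩
      exact (isUniqueZeroSum_replicate (g := a) (t := t) (by omega) (by omega)).mem_Qset
        (by omega) (by simp)
  · refine Set.eq_empty_of_forall_notMem fun W hW => ?_
    have hW0 : W ≠ Multiset.replicate (t - Nat.card G + 1) 0 := by
      rintro rfl
      exact replicate_zero_notMem_Qset_of_le hg hn ht (by omega) (by omega) hW
    refine notMem_Qset_of_ne_replicate_zero hg hn (by omega) hW0 (fun a _ => ?_) hW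
    have := Nat.le_of_dvd (by omega) (addOrderOf_dvd_natCard a)
    omega
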